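/- Let $\mathbb U$ be the Urysohn sphere: the unique (up to isometry) metric space that is separable, complete, ultrahomogeneous (every isometry between finite subsets extends to an isometry of $\mathbb U$ onto itself), has metric bounded by $1$, and contains an isometric copy of every separable metric space with metric bounded by $1$. Let $\mathcal L$ be a countable language for continuous logic, i.e. a countable set of function symbols $f$ and relation symbols $R$, each with a finite arity $n_f$, $n_R$ and a modulus of continuity $\varpi_f,\varpi_R\colon[0,\infty)\to[0,\infty)$, continuous and vanishing at $0$. Let $\mathrm{Unif}_{\varpi}(X,Z)$ be the set of maps $h\colon X\to Z$ with $d(h(a),h(b))\le\varpi(d(a,b))$ for all $a,b$, with the topology of pointwise convergence, and let $$\mathrm{Mod}(\mathcal L,\mathbb U)=\prod_f \mathrm{Unif}_{\varpi_f}(\mathbb U^{n_f},\mathbb U)\times\prod_R \mathrm{Unif}_{\varpi_R}(\mathbb U^{n_R},[0,1]),$$ where powers carry the maximum metric; $\mathrm{Iso}(\mathbb U)$ acts on it by $f^{gM}(a)=g f^M(g^{-1}a)$ and $R^{gM}(a)=R^M(g^{-1}a)$. A grey subset of $\mathrm{Mod}(\mathcal L,\mathbb U)$ is a function $A\colon\mathrm{Mod}(\mathcal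 L,\mathbb U)\to[0,1]$; it is Borel if it is a Borel function, and $\mathrm{Iso}(\mathbb U)$-invariant if $A(gM)=A(M)$ for all $g$ and $M$. Formulas of $\mathcal L_{\omega_1\omega}$ are built from the atomic formulas $d(t_1,t_2)$ and $R(t_1,\dots,t_n)$ ($t_i$ terms) by continuous connectives $h\colon[0,1]^k\to[0,1]$, quantifiers $\inf_x$ and $\sup_x$, and countable infima $\inf_n\varphi_n$ and suprema $\sup_n\varphi_n$ of sequences of formulas with finitely many free variables among them all, whose moduli of continuity (computed by recursion on the formula, as functions of the variation of each free variable) are bounded by a single modulus of continuity. A sentence is a formula without free variables; its value in $M$ is $\varphi^M\in[0,1]$. Theorem. For every $\mathrm{Iso}(\mathbb U)$-invariant Borel grey subset $A$ of $\mathrm{Mod}(\mathcal L,\mathbb U)$ there is a sentence $\varphi$ of $\mathcal L_{\omega_1\omega}$ such that $A(M)=\varphi^M$ for all $M\in\mathrm{Mod}(\mathcal L,\mathbb U)$. -/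

import Mathlib

open scoped unitInterval NNReal ENNReal

universe u v w

namespace MetricLogic

/-! ### Languages and metric structures -/

/-- A modulus of continuity: a continuous function `[0,∞) → [0,∞)` vanishing at `0`. -/
structure Modulus where
  toFun : ℝ≥0 → ℝ≥0
  continuous_toFun : Continuous toFun
  map_zero : toFun 0 = 0

/-- A language for metric structures: function and relation symbols, each with a finite arity
and a modulus of continuity.  The symbol `d` for the metric is not listed among the symbols;
it is a separate constructor of formulas. -/
structure MetricLanguage extends FirstOrder.Language.{u, v} where
  funModulus : ∀ {n : ℕ}, Functions n → Modulus
  relModulus : ∀ {n : ℕ}, Relations n → Modulus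

/-- The metric of `Y` is bounded by `1`. -/
class MetricBoundedByOne (Y : Type w) [MetricSpace Y] : Prop where
  dist_le_one : ∀ x y : Y, dist x y ≤ 1

/-- The space of `ϖ`-uniformly continuous functions from `X` to `Z`. As a subtype of the
product `X → Z`, it carries the topology of pointwise convergence. -/
abbrev Unif (ϖ : Modulus) (X Z : Type*) [PseudoMetricSpace X] [PseudoMetricSpace Z] : Type _ :=
  {f : X → Z // ∀ a b, nndist (f a) (f b) ≤ ϖ.toFun (nndist a b)}

/-- `Mod(L, Y)`: the space of `L`-structures with support `Y`. The powers `Fin n → Y` carry the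
maximum metric. -/
def Mod (L : MetricLanguage.{u, v}) (Y : Type w) [MetricSpace Y] : Type (max u v w) :=
  (∀ s : (Σ n, L.Functions n), Unif (L.funModulus s.2) (Fin s.1 → Y) Y) ×
    (∀ s : (Σ n, L.Relations n), Unif (L.relModulus s.2) (Fin s.1 → Y) I)

namespace Mod

variable {L : MetricLanguage.{u, v}} {Y : Type w} [MetricSpace Y]

/-- The product of the topologies of pointwise convergence. -/
instance : TopologicalSpace (Mod L Y) :=
  inferInstanceAs (TopologicalSpace
    ((∀ s : (Σ n, L.Functions n), Unif (L.funModulus s.2) (Fin s.1 → Y) Y) ×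
      (∀ s : (Σ n, L.Relations n), Unif (L.relModulus s.2) (Fin s.1 → Y) I)))

/-- The interpretation `f^M` of a function symbol. -/
def funMap (M : Mod L Y) {n : ℕ} (f : L.Functions n) : (Fin n → Y) → Y := (M.1 ⟨n, f⟩).1

/-- The interpretation `R^M` of a relation symbol. -/
def relMap (M : Mod L Y) {n : ℕ} (R : L.Relations n) : (Fin n → Y) → I := (M.2 ⟨n, R⟩).1

theorem nndist_isometryEquiv_comp (g : Y ≃ᵢ Y) {n : ℕ} (a b : Fin n → Y) :
    nndist (fun i => g (a i)) (fun i => g (b i)) = nndist a b := by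
  simp only [nndist_pi_def, g.isometry.nndist_eq]

/-- The natural action of `Iso(Y)` on `Mod(L, Y)`: `f^{gM}(a) = g (f^M (g⁻¹ a))` and
`R^{gM}(a) = R^M (g⁻¹ a)`. -/
instance : SMul (Y ≃ᵢ Y) (Mod L Y) where
  smul g M :=
    (fun s => ⟨fun a => g (M.funMap s.2 fun i => g⁻¹ (a i)), fun a b => by
        rw [g.isometry.nndist_eq, ← nndist_isometryEquiv_comp g⁻¹ a b]
        exact (M.1 s).2 _ _⟩,
      fun s => ⟨fun a => M.relMap s.2 fun i => g⁻¹ (a i), fun a b => by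
        rw [← nndist_isometryEquiv_comp g⁻¹ a b]
        exact (M.2 s).2 _ _⟩)

end Mod

/-! ### Formulas of `L_{ω₁ω}` -/

/-- Formal expressions of `L_{ω₁ω}` with free variables indexed by `Fin n`, before the condition
on countable infima and suprema is imposed. A quantifier binds the last variable. -/
inductive PreFormula (L : MetricLanguage.{u, v}) : ℕ → Type (max u v)
  | dist {n : ℕ} (t₁ t₂ : L.toLanguage.Term (Fin n)) : PreFormula L n
  | rel {n l : ℕ} (R : L.Relations l) (ts : Fin l → L.toLanguage.Term (Fin n)) : PreFormula L n
  | conn {n k : ℕ} (h : C(Fin k → I, I)) (φ : Fin k → PreFormula L n) : PreFormula L n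
  | inf {n : ℕ} (φ : PreFormula L (n + 1)) : PreFormula L n
  | sup {n : ℕ} (φ : PreFormula L (n + 1)) : PreFormula L n
  | iInf {n : ℕ} (φ : ℕ → PreFormula L n) : PreFormula L n
  | iSup {n : ℕ} (φ : ℕ → PreFormula L n) : PreFormula L n

/-- The bound `sup_{s ≤ e} ϖ(s)` (a modulus is not assumed to be monotone). -/
noncomputable def Modulus.bound (ϖ : Modulus) (e : ℝ≥0∞) : ℝ≥0∞ :=
  ⨆ (s : ℝ≥0) (_ : (s : ℝ≥0∞) ≤ e), (ϖ.toFun s : ℝ≥0∞)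

/-- The modulus of continuity of a term `t`: when the `i`-th variable moves by at most `δ i`, the
value of `t` moves by at most `termModulus t δ`. -/
noncomputable def termModulus {L : MetricLanguage.{u, v}} {n : ℕ} (δ : Fin n → ℝ≥0∞) :
    L.toLanguage.Term (Fin n) → ℝ≥0∞
  | .var i => δ i
  | .func f ts => (L.funModulus f).bound (⨆ j, termModulus δ (ts j))

namespace PreFormula

variable {L : MetricLanguage.{u, v}}

/-- The modulus of continuity `ϖ_φ` of an expression, by recursion on `φ`: when the `i`-th free
variable moves by at most `δ i`, the value of `φ` moves by at most `φ.modulus δ`. -/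
noncomputable def modulus : {n : ℕ} → PreFormula L n → (Fin n → ℝ≥0∞) → ℝ≥0∞
  | _, .dist t₁ t₂, δ => termModulus δ t₁ + termModulus δ t₂
  | _, .rel R ts, δ => (L.relModulus R).bound (⨆ j, termModulus δ (ts j))
  | _, .conn (k := k) h φ, δ =>
      ⨆ (a : Fin k → I) (b : Fin k → I) (_ : ∀ i, edist (a i) (b i) ≤ (φ i).modulus δ),
        edist (h a) (h b)
  | n, .inf φ, δ => φ.modulus (Fin.snoc (α := fun _ : Fin (n + 1) => ℝ≥0∞) δ 0)
  | n, .sup φ, δ => φ.modulus (Fin.snoc (α := fun _ : Fin (n + 1) => ℝ≥0∞) δ 0)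
  | _, .iInf φ, δ => ⨆ m, (φ m).modulus δ
  | _, .iSup φ, δ => ⨆ m, (φ m).modulus δ

/-- The moduli of continuity of a sequence of expressions, with respect to the maximum metric on
tuples, are bounded by a single modulus of continuity. -/
def UniformlyBounded {n : ℕ} (φ : ℕ → PreFormula L n) : Prop :=
  ∃ Δ : Modulus, ∀ (m : ℕ) (t : ℝ≥0), (φ m).modulus (fun _ => (t : ℝ≥0∞)) ≤ (Δ.toFun t : ℝ≥0∞)

/-- The expression is a formula of `L_{ω₁ω}`: every countable infimum and supremum in it is taken
over a sequence whose moduli of continuity are uniformly bounded. -/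
def IsFormula : {n : ℕ} → PreFormula L n → Prop
  | _, .dist _ _ => True
  | _, .rel _ _ => True
  | _, .conn _ φ => ∀ i, (φ i).IsFormula
  | _, .inf φ => φ.IsFormula
  | _, .sup φ => φ.IsFormula
  | _, .iInf φ => (∀ m, (φ m).IsFormula) ∧ UniformlyBounded φ
  | _, .iSup φ => (∀ m, (φ m).IsFormula) ∧ UniformlyBounded φ

end PreFormula

/-- Formulas of `L_{ω₁ω}` with free variables indexed by `Fin n`. -/
def Formula (L : MetricLanguage.{u, v}) (n : ℕ) : Type (max u v) :=
  {φ : PreFormula L n // φ.IsFormula}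

/-- Sentences of `L_{ω₁ω}`. -/
abbrev Sentence (L : MetricLanguage.{u, v}) : Type (max u v) := Formula L 0

/-! ### Evaluation -/

section Eval

variable {L : MetricLanguage.{u, v}} {Y : Type w} [MetricSpace Y]

/-- The value `t^M(a)` of a term. -/
def termEval (M : Mod L Y) {n : ℕ} (a : Fin n → Y) : L.toLanguage.Term (Fin n) → Y
  | .var i => a i
  | .func f ts => M.funMap f fun j => termEval M a (ts j)

variable [MetricBoundedByOne Y]

/-- The value of an expression at a tuple; infima and suprema are taken in `[0,1]`. -/
noncomputable def PreFormula.eval (M : Mod L Y) :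
    {n : ℕ} → PreFormula L n → (Fin n → Y) → I
  | _, .dist t₁ t₂, a =>
      ⟨Dist.dist (termEval M a t₁) (termEval M a t₂),
        dist_nonneg, MetricBoundedByOne.dist_le_one _ _⟩
  | _, .rel R ts, a => M.relMap R fun j => termEval M a (ts j)
  | _, .conn h φ, a => h fun i => (φ i).eval M a
  | n, .inf φ, a => ⨅ y : Y, φ.eval M (Fin.snoc (α := fun _ : Fin (n + 1) => Y) a y)
  | n, .sup φ, a => ⨆ y : Y, φ.eval M (Fin.snoc (α := fun _ : Fin (n + 1) => Y) a y)
  | _, .iInf φ, a => ⨅ m, (φ m).eval M a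
  | _, .iSup φ, a => ⨆ m, (φ m).eval M a

/-- The value `φ^M ∈ [0,1]` of a sentence. -/
noncomputable def Sentence.eval (φ : Sentence L) (M : Mod L Y) : I :=
  φ.1.eval M (fun i => i.elim0)

end Eval

/-! ### The Urysohn sphere and grey subsets -/

/-- `U` is the Urysohn sphere: the metric is bounded by `1`, the space is complete, separable and
ultrahomogeneous, and it contains an isometric copy of every separable metric space with metric
bounded by `1` (up to isometry, every separable metric space lives in `Type`). -/
class UrysohnSphere (U : Type w) [MetricSpace U] : Prop extends MetricBoundedByOne U where
  complete : CompleteSpace U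
  separable : TopologicalSpace.SeparableSpace U
  ultrahomogeneous : ∀ s : Set U, s.Finite → ∀ f : s → U, Isometry f →
    ∃ g : U ≃ᵢ U, ∀ x : s, g (x : U) = f x
  universal : ∀ (X : Type) [MetricSpace X] [TopologicalSpace.SeparableSpace X]
    [MetricBoundedByOne X], ∃ f : X → U, Isometry f

/-- A grey subset of `X` is a function `X → [0,1]`. -/
abbrev GreySubset (X : Type*) : Type _ := X → I

/-- A grey subset of a topological space is Borel if it is Borel as a function into `[0,1]`. -/
def GreySubset.IsBorel {X : Type*} [TopologicalSpace X] (A : GreySubset X) : Prop :=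
  @Measurable X I (borel X) (borel I) A

/-- A grey subset of a space with an action of `G` is invariant if it is constant on orbits. -/
def GreySubset.IsInvariant (G : Type*) {X : Type*} [SMul G X] (A : GreySubset X) : Prop :=
  ∀ (g : G) (x : X), A (g • x) = A x

end MetricLogic

/-!
The proof follows Vaught's proof of the López-Escobar theorem, with distances in place of truth
values. Let `q` be a dense sequence in the Urysohn sphere `U`, and let `Iso(U)` carry the topology
of pointwise convergence, which makes it a Baire space. To a set `B` of structures, a structure `M`
and a tuple `a` of length `k` one associates the essential distance `vaughtDist q B k M a`, in the
sense of Baire category, from `a` to the tuples `(g q₀, …, g qₖ₋₁)` with `g⁻¹M ∈ B`. If `B` is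
invariant then `vaughtDist q B 0 M` is `0` or `1` according to whether `M ∈ B`, so an invariant
Borel function `A` is the supremum over a dense set of `r ∈ [0,1]` of
`min r (1 - vaughtDist q {A > r} 0 M)`. Hence it suffices that, for every Borel `B`, the essential
distance is given by a formula whose modulus of continuity is the identity; the common modulus is
what permits countable infima.

The sets `B` with this property form a σ-algebra. Countable unions turn into countable infima
(`vaughtDist_iUnion`). For complements (`IsVaughtDefinable.compl`), a set with the property of Baire
is nonmeagre in an open set iff it is comeagre in a smaller one, which can be taken of the form
`{g | d(g q, b) < δ}` with `q` a longer initial segment of the sequence and `b = g₀ q`. So the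
distance to `Bᶜ` is an infimum over tuples `b` on which the distance to `B` is positive. The infimum
has to run over the `b` of the form `g₀ q`, which is not expressible exactly, but by approximate
homogeneity of `U` (`UrysohnSphere.exists_dist_apply_le`) such a `g₀ q` exists within `ε` of `b`
once the metrics of `b` and `q` agree up to `ε`; it is therefore enough to add a multiple of the
discrepancy of the two metrics as a penalty. `definable_vaughtDist` carries this out, for
complements and also for the open conditions given by atomic formulas. The latter generate the Borel
sets (`Mod.borel_le`), since the interpretations of each symbol are equicontinuous.
-/

namespace MetricLogic

open Filter Topology Set
open scoped MeasureTheory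

/-! ### The isometry group as a Baire space -/

section IsometryGroup

variable {U : Type w} [MetricSpace U]

/-- The topology of pointwise convergence on the group of isometries of `U` onto itself. -/
instance isometryEquivTopology : TopologicalSpace (U ≃ᵢ U) :=
  TopologicalSpace.induced (fun g : U ≃ᵢ U => (g : U → U)) inferInstance

theorem continuous_isometryEquiv_apply (x : U) : Continuous fun g : U ≃ᵢ U => g x :=
  (continuous_apply x).comp continuous_induced_dom

/-- As isometries are equicontinuous, convergence on a dense set implies convergence. -/
theorem tendsto_isometryEquiv_of_dense {ι α : Type*} {q : ι → U} (hq : DenseRange q)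
    {F : Filter α} {φ : α → U ≃ᵢ U} {g : U ≃ᵢ U}
    (h : ∀ i, Tendsto (fun a => φ a (q i)) F (𝓝 (g (q i)))) : Tendsto φ F (𝓝 g) := by
  rw [nhds_induced, tendsto_comap_iff, tendsto_pi_nhds]
  intro x
  rw [Metric.tendsto_nhds]
  intro ε hε
  obtain ⟨i, hi⟩ := hq.exists_dist_lt x (by positivity : 0 < ε / 3)
  filter_upwards [Metric.tendsto_nhds.1 (h i) (ε / 3) (by positivity)] with a ha
  have h1 := dist_triangle4 (φ a x) (φ a (q i)) (g (q i)) (g x)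
  rw [(φ a).dist_eq, g.dist_eq, dist_comm (q i) x] at h1
  simp only [Function.comp_apply]
  linarith

theorem continuous_isometryEquiv_symm_apply (x : U) : Continuous fun g : U ≃ᵢ U => g.symm x := by
  rw [continuous_iff_continuousAt]
  intro g
  have h1 : Tendsto (fun k : U ≃ᵢ U => dist (k (g.symm x)) x) (𝓝 g) (𝓝 0) := by
    have := ((continuous_isometryEquiv_apply (g.symm x)).dist
      (continuous_const (y := x))).tendsto g
    simpa using this
  refine tendsto_iff_dist_tendsto_zero.2 (h1.congr fun k => ?_)
  rw [← k.dist_eq (k.symm x), k.apply_symm_apply, dist_comm]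

/-- The sets of those isometries that are close to `g` on a long enough initial segment of a
dense sequence form a neighbourhood basis of `g`. -/
theorem exists_dist_lt_imp_mem_of_mem_nhds {q : ℕ → U} (hq : DenseRange q) {g : U ≃ᵢ U}
    {V : Set (U ≃ᵢ U)} (hV : V ∈ 𝓝 g) (k : ℕ) :
    ∃ m, k ≤ m ∧ ∃ δ > 0, ∀ h : U ≃ᵢ U,
      dist (fun i : Fin m => h (q i)) (fun i : Fin m => g (q i)) < δ → h ∈ V := by
  by_contra! hcon
  choose f hf hfV using fun n : ℕ =>
    hcon (max k n) (le_max_left _ _) (1 / ((n : ℝ) + 1)) (by positivity)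
  have hlim : Tendsto f atTop (𝓝 g) := by
    refine tendsto_isometryEquiv_of_dense hq fun i => tendsto_iff_dist_tendsto_zero.2 ?_
    refine squeeze_zero' (.of_forall fun _ => dist_nonneg) ?_
      tendsto_one_div_add_atTop_nhds_zero_nat
    filter_upwards [eventually_gt_atTop i] with n hn
    exact (dist_le_pi_dist (fun j : Fin (max k n) => f n (q j)) (fun j => g (q j))
      ⟨i, lt_max_of_lt_right hn⟩).trans (hf n).le
  obtain ⟨n, hn⟩ := (hlim.eventually hV).exists
  exact hfV n hn

theorem exists_isometry_of_dist_eq [CompleteSpace U] {ι : Type*} {q x : ι → U}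
    (hq : DenseRange q) (hx : ∀ i j, dist (x i) (x j) = dist (q i) (q j)) :
    ∃ g : U → U, Isometry g ∧ ∀ i, g (q i) = x i := by
  let : PseudoMetricSpace ι := PseudoMetricSpace.induced q inferInstance
  have hqi : Isometry q := Isometry.of_dist_eq fun _ _ => rfl
  have hxi : Isometry x := Isometry.of_dist_eq hx
  have hd : IsDenseInducing q := ⟨hqi.isUniformInducing.isInducing, hq⟩
  have hc : Continuous (hd.extend x) :=
    (uniformContinuous_uniformly_extend hqi.isUniformInducing hq
      hxi.uniformContinuous).continuous
  have he : ∀ i, hd.extend x (q i) = x i := hd.extend_eq hxi.continuous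
  refine ⟨hd.extend x, Isometry.of_dist_eq fun u v => ?_, he⟩
  refine hq.induction_on₂ (p := fun u v => dist (hd.extend x u) (hd.extend x v) = dist u v)
    (isClosed_eq (by fun_prop) (by fun_prop)) (fun i j => ?_) u v
  rw [he, he, hx]

/-- `g ↦ (g, g⁻¹)`, restricted to a dense sequence, is a closed embedding of the isometry group
into a countable power of `U`: a pair `(x, y)` of sequences comes from an isometry and its
inverse as soon as `x` and `y` extend to isometries and `d(x i, q j) = d(q i, y j)`. -/
theorem isClosedEmbedding_isometryEquiv [CompleteSpace U] {q : ℕ → U} (hq : DenseRange q) :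
    IsClosedEmbedding fun g : U ≃ᵢ U => ((fun i => g (q i), fun i => g.symm (q i)) :
      (ℕ → U) × (ℕ → U)) := by
  have hcont : Continuous fun g : U ≃ᵢ U => ((fun i => g (q i), fun i => g.symm (q i)) :
      (ℕ → U) × (ℕ → U)) :=
    (continuous_pi fun i => continuous_isometryEquiv_apply (q i)).prodMk
      (continuous_pi fun i => continuous_isometryEquiv_symm_apply (q i))
  refine ⟨⟨isInducing_iff_nhds.2 fun g => le_antisymm hcont.continuousAt.le_comap ?_, ?_⟩, ?_⟩
  · rw [← tendsto_id']
    refine tendsto_isometryEquiv_of_dense hq fun i => ?_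
    have hi : Continuous fun p : (ℕ → U) × (ℕ → U) => p.1 i := by fun_prop
    exact (hi.tendsto _).comp tendsto_comap
  · intro g h hgh
    ext x
    have : (fun i => g (q i)) = fun i => h (q i) := congrArg Prod.fst hgh
    exact congrFun (hq.equalizer g.continuous h.continuous this) x
  · have : range (fun g : U ≃ᵢ U => ((fun i => g (q i), fun i => g.symm (q i)) :
        (ℕ → U) × (ℕ → U))) = {p | ∀ i j, dist (p.1 i) (p.1 j) = dist (q i) (q j) ∧
          dist (p.2 i) (p.2 j) = dist (q i) (q j) ∧ dist (p.1 i) (q j) = dist (q i) (p.2 j)} := by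
      ext ⟨x, y⟩
      constructor
      · rintro ⟨g, hg⟩ i j
        cases hg
        refine ⟨g.dist_eq _ _, g.symm.dist_eq _ _, ?_⟩
        dsimp only
        rw [← g.dist_eq (q i), g.apply_symm_apply]
      · intro hxy
        obtain ⟨g, hg, hgx⟩ := exists_isometry_of_dist_eq hq fun i j => (hxy i j).1
        obtain ⟨h, hh, hhy⟩ := exists_isometry_of_dist_eq hq fun i j => (hxy i j).2.1
        have hgh : ∀ u v, dist (g u) v = dist u (h v) := fun u v => by
          have hgc := hg.continuous
          have hhc := hh.continuous
          refine hq.induction_on₂ (p := fun u v => dist (g u) v = dist u (h v))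
            (isClosed_eq (by fun_prop) (by fun_prop)) (fun i j => ?_) u v
          rw [hgx, hhy]
          exact (hxy i j).2.2
        refine ⟨IsometryEquiv.mk' g h (fun v => ?_) hg, ?_⟩
        · rw [← dist_eq_zero, hgh, dist_self]
        · exact Prod.ext (funext hgx) (funext hhy)
    rw [this]
    simp only [ofPred_forall, ofPred_and]
    refine isClosed_iInter fun i => isClosed_iInter fun j => ?_
    refine (isClosed_eq (by fun_prop) (by fun_prop)).inter
      ((isClosed_eq (by fun_prop) (by fun_prop)).inter (isClosed_eq (by fun_prop) (by fun_prop)))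

theorem baireSpace_isometryEquiv [CompleteSpace U] {q : ℕ → U} (hq : DenseRange q) :
    BaireSpace (U ≃ᵢ U) := by
  have := (isClosedEmbedding_isometryEquiv hq).IsCompletelyMetrizableSpace
  let := TopologicalSpace.upgradeIsCompletelyMetrizable (U ≃ᵢ U)
  infer_instance

end IsometryGroup

/-! ### Approximate homogeneity of the Urysohn sphere -/

section Homogeneity

variable {U : Type w} [MetricSpace U]

theorem UrysohnSphere.exists_isometryEquiv_of_dist_eq [UrysohnSphere U] {m : ℕ} {x y : Fin m → U}
    (h : ∀ i j, dist (x i) (x j) = dist (y i) (y j)) : ∃ g : U ≃ᵢ U, ∀ i, g (x i) = y i := by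
  have hch : ∀ s : range x, ∃ i, x i = s := fun s => s.2
  choose c hc using hch
  obtain ⟨g, hg⟩ := UrysohnSphere.ultrahomogeneous (range x) (finite_range x)
    (fun s => y (c s)) (Isometry.of_dist_eq fun s t => by rw [← h, hc, hc]; rfl)
  refine ⟨g, fun i => (hg ⟨x i, i, rfl⟩).trans ?_⟩
  rw [← dist_eq_zero, ← h, hc, dist_self]

theorem UrysohnSphere.exists_dist_eq [UrysohnSphere U] (T : Type) [Finite T]
    [PseudoMetricSpace T] (hT : ∀ s t : T, dist s t ≤ 1) :
    ∃ f : T → U, ∀ s t, dist (f s) (f t) = dist s t := by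
  have : MetricBoundedByOne (SeparationQuotient T) := ⟨fun s t => by
    obtain ⟨s, rfl⟩ := SeparationQuotient.surjective_mk s
    obtain ⟨t, rfl⟩ := SeparationQuotient.surjective_mk t
    exact hT s t⟩
  have : Finite (SeparationQuotient T) := Finite.of_surjective _ SeparationQuotient.surjective_mk
  obtain ⟨f, hf⟩ := UrysohnSphere.universal (U := U) (SeparationQuotient T)
  exact ⟨fun t => f (SeparationQuotient.mk t), fun s t => hf.dist_eq _ _⟩

/-- If the metrics of two tuples differ by at most `ε`, then the tuples can be amalgamated into a
metric space in which they are `ε`-close; embedding it into `U` and applying homogeneity to each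
tuple brings one `ε`-close to the other. -/
theorem UrysohnSphere.exists_dist_apply_le [UrysohnSphere U] {m : ℕ} {x y : Fin m → U} {ε : ℝ}
    (hε : 0 < ε) (h : ∀ i j, |dist (x i) (x j) - dist (y i) (y j)| ≤ ε) :
    ∃ g : U ≃ᵢ U, ∀ i, dist (g (x i)) (y i) ≤ ε := by
  rcases m.eq_zero_or_pos with rfl | hm
  · exact ⟨1, fun i => i.elim0⟩
  have : Nonempty (Fin m) := ⟨⟨0, hm⟩⟩
  let := Metric.glueMetricApprox x y ε hε fun i j => (h i j).trans (by linarith)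
  let z : Fin m ⊕ Fin m → U ⊕ U := Sum.map x y
  let : PseudoMetricSpace (Fin m ⊕ Fin m) :=
    { dist := fun s t => min 1 (dist (z s) (z t))
      dist_self := fun s => by simp
      dist_comm := fun s t => by rw [dist_comm]
      dist_triangle := fun r s t => by
        have := dist_triangle (z r) (z s) (z t)
        have := dist_nonneg (x := z r) (y := z s)
        have := dist_nonneg (x := z s) (y := z t)
        rcases le_total 1 (dist (z r) (z s)) with h1 | h1 <;>
          rcases le_total 1 (dist (z s) (z t)) with h2 | h2 <;>
          simp only [min_eq_left, min_eq_right, h1, h2] <;>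
          first
            | exact (min_le_left _ _).trans (by linarith)
            | exact (min_le_right _ _).trans (by linarith) }
  obtain ⟨f, hf⟩ := UrysohnSphere.exists_dist_eq (U := U) (Fin m ⊕ Fin m)
    fun s t => min_le_left _ _
  have hb := MetricBoundedByOne.dist_le_one (Y := U)
  obtain ⟨g₁, hg₁⟩ := UrysohnSphere.exists_isometryEquiv_of_dist_eq
    (x := x) (y := fun i => f (.inl i)) fun i j => by
      rw [hf]; exact (min_eq_right (hb (x i) (x j))).symm
  obtain ⟨g₂, hg₂⟩ := UrysohnSphere.exists_isometryEquiv_of_dist_eq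
    (x := y) (y := fun i => f (.inr i)) fun i j => by
      rw [hf]; exact (min_eq_right (hb (y i) (y j))).symm
  refine ⟨g₁.trans g₂.symm, fun i => ?_⟩
  rw [IsometryEquiv.trans_apply, ← g₂.dist_eq, g₂.apply_symm_apply, hg₁, hg₂, hf]
  exact (min_le_right _ _).trans (Metric.glueDist_glued_points x y ε i).le

end Homogeneity

/-! ### Definable predicates -/

section Definable

variable {L : MetricLanguage.{u, v}} {U : Type w} [MetricSpace U] [MetricBoundedByOne U]

/-- A predicate `F`, a function of a structure and an `n`-tuple, is definable with modulus at most
`w` if it is given by a formula `φ` of `L_{ω₁ω}` whose syntactic modulus satisfies `ϖ_φ ≤ w`. -/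
def Definable {n : ℕ} (F : Mod L U → (Fin n → U) → I) (w : (Fin n → ℝ≥0∞) → ℝ≥0∞) : Prop :=
  ∃ φ : PreFormula L n, φ.IsFormula ∧ (∀ M a, φ.eval M a = F M a) ∧ ∀ δ, φ.modulus δ ≤ w δ

theorem Definable.dist {n : ℕ} (t₁ t₂ : L.toLanguage.Term (Fin n)) :
    Definable (fun (M : Mod L U) a => ⟨dist (termEval M a t₁) (termEval M a t₂),
      dist_nonneg, MetricBoundedByOne.dist_le_one _ _⟩)
      fun δ => termModulus δ t₁ + termModulus δ t₂ :=
  ⟨.dist t₁ t₂, trivial, fun _ _ => rfl, fun _ => le_rfl⟩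

theorem Definable.rel {n l : ℕ} (R : L.Relations l) (ts : Fin l → L.toLanguage.Term (Fin n)) :
    Definable (fun (M : Mod L U) a => M.relMap R fun j => termEval M a (ts j))
      fun δ => (L.relModulus R).bound (⨆ j, termModulus δ (ts j)) :=
  ⟨.rel R ts, trivial, fun _ _ => rfl, fun _ => le_rfl⟩

theorem Definable.mono {n : ℕ} {F : Mod L U → (Fin n → U) → I}
    {w w' : (Fin n → ℝ≥0∞) → ℝ≥0∞} (hF : Definable F w) (hw : ∀ δ, w δ ≤ w' δ) :
    Definable F w' := by
  obtain ⟨φ, hφ, hφF, hφw⟩ := hF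
  exact ⟨φ, hφ, hφF, fun δ => (hφw δ).trans (hw δ)⟩

theorem Definable.conn {n : ℕ} {ι : Type*} [Finite ι] {F : ι → Mod L U → (Fin n → U) → I}
    {w : ι → (Fin n → ℝ≥0∞) → ℝ≥0∞} (hF : ∀ i, Definable (F i) (w i)) {h : (ι → I) → I}
    (hc : Continuous h) :
    Definable (fun M a => h fun i => F i M a) fun δ =>
      ⨆ (a : ι → I) (b : ι → I) (_ : ∀ i, edist (a i) (b i) ≤ w i δ), edist (h a) (h b) := by
  choose φ hφ hφF hφw using hF
  obtain ⟨k, ⟨e⟩⟩ := Finite.exists_equiv_fin ι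
  have hk : Continuous fun x : Fin k → I => h fun i => x (e i) := by fun_prop
  refine ⟨.conn (k := k) ⟨_, hk⟩ fun j => φ (e.symm j),
    fun j : Fin k => hφ (e.symm j), fun M a => ?_, fun δ => ?_⟩
  · simp [PreFormula.eval, hφF]
  · refine iSup_le fun a => iSup_le fun b => iSup_le fun hab => ?_
    refine le_iSup_of_le (fun i => a (e i)) (le_iSup_of_le (fun i => b (e i))
      (le_iSup_of_le (fun i => (hab (e i)).trans ?_) le_rfl))
    dsimp only
    rw [e.symm_apply_apply]
    exact hφw i δ

theorem Definable.comp {n : ℕ} {F : Mod L U → (Fin n → U) → I}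
    {w : (Fin n → ℝ≥0∞) → ℝ≥0∞} (hF : Definable F w) {h : I → I} (hc : Continuous h) :
    ∃ w', Definable (fun M a => h (F M a)) w' ∧ ∀ δ, w δ = 0 → w' δ = 0 := by
  refine ⟨_, Definable.conn (ι := Unit) (fun _ => hF) (h := fun x => h (x ()))
    (hc.comp (continuous_apply ())), fun δ hδ => ?_⟩
  simp only [hδ, nonpos_iff_eq_zero, edist_eq_zero, ENNReal.iSup_eq_zero]
  intro a b hab
  rw [hab ()]

theorem Definable.const {n : ℕ} (c : I) (w : (Fin n → ℝ≥0∞) → ℝ≥0∞) :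
    Definable (fun (_ : Mod L U) _ => c) w :=
  (Definable.conn (ι := Empty) (F := fun i => i.elim) (w := fun i => i.elim) (fun i => i.elim)
    (h := fun _ => c) continuous_const).mono fun δ => by simp

theorem Definable.iInf_nat {n : ℕ} {F : ℕ → Mod L U → (Fin n → U) → I}
    {w : (Fin n → ℝ≥0∞) → ℝ≥0∞} (hF : ∀ i, Definable (F i) w)
    (hw : ∀ t : ℝ≥0, w (fun _ => t) ≤ t) : Definable (fun M a => ⨅ i, F i M a) w := by
  choose φ hφ hφF hφw using hF
  exact ⟨.iInf φ, ⟨hφ, ⟨id, continuous_id, rfl⟩, fun m t => (hφw m _).trans (hw t)⟩,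
    fun M a => by simp [PreFormula.eval, hφF], fun δ => iSup_le fun m => hφw m δ⟩

theorem Definable.iInf {n : ℕ} {ι : Type*} [Countable ι] {F : ι → Mod L U → (Fin n → U) → I}
    {w : (Fin n → ℝ≥0∞) → ℝ≥0∞} (hF : ∀ i, Definable (F i) w)
    (hw : ∀ t : ℝ≥0, w (fun _ => t) ≤ t) : Definable (fun M a => ⨅ i, F i M a) w := by
  rcases isEmpty_or_nonempty ι with hι | hι
  · simpa only [iInf_of_empty] using Definable.const (⊤ : I) w
  · obtain ⟨e, he⟩ := exists_surjective_nat ι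
    have : (fun M a => ⨅ i, F i M a) = fun M a => ⨅ j, F (e j) M a := by
      ext1 M
      ext1 a
      exact (he.iInf_comp (g := fun i => F i M a)).symm
    rw [this]
    exact Definable.iInf_nat (fun i => hF (e i)) hw

theorem Definable.iSup_nat {n : ℕ} {F : ℕ → Mod L U → (Fin n → U) → I}
    {w : (Fin n → ℝ≥0∞) → ℝ≥0∞} (hF : ∀ i, Definable (F i) w)
    (hw : ∀ t : ℝ≥0, w (fun _ => t) ≤ t) : Definable (fun M a => ⨆ i, F i M a) w := by
  choose φ hφ hφF hφw using hF
  exact ⟨.iSup φ, ⟨hφ, ⟨id, continuous_id, rfl⟩, fun m t => (hφw m _).trans (hw t)⟩,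
    fun M a => by simp [PreFormula.eval, hφF], fun δ => iSup_le fun m => hφw m δ⟩

theorem Definable.iInf_snoc {n : ℕ} {F : Mod L U → (Fin (n + 1) → U) → I}
    {w : (Fin (n + 1) → ℝ≥0∞) → ℝ≥0∞} (hF : Definable F w) :
    Definable (fun M (a : Fin n → U) => ⨅ y : U, F M (Fin.snoc (α := fun _ => U) a y))
      fun δ => w (Fin.snoc (α := fun _ => ℝ≥0∞) δ 0) := by
  obtain ⟨φ, hφ, hφF, hφw⟩ := hF
  exact ⟨.inf φ, hφ, fun M a => by simp only [PreFormula.eval, hφF], fun δ => hφw _⟩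

/-- An infimum over `m`-tuples is an iterated quantifier. -/
theorem Definable.iInf_append {n m : ℕ} {F : Mod L U → (Fin (n + m) → U) → I}
    {w : (Fin (n + m) → ℝ≥0∞) → ℝ≥0∞} (hF : Definable F w) :
    Definable (fun M (a : Fin n → U) => ⨅ b : Fin m → U, F M (Fin.append a b))
      fun δ => w (Fin.append δ fun _ => 0) := by
  induction m with
  | zero =>
    simpa [Fin.append_right_nil, iInf_unique] using hF
  | succ m ih =>
    convert ih (Definable.iInf_snoc (n := n + m) hF) using 4 with M a δ
    · apply le_antisymm
      · refine le_iInf fun b => le_iInf fun y => (iInf_le _ (Fin.snoc b y)).trans_eq ?_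
        rw [Fin.append_snoc]
      · refine le_iInf fun b => (iInf_le _ (Fin.init b)).trans
          ((iInf_le _ (b (Fin.last m))).trans_eq ?_)
        rw [← Fin.append_snoc, Fin.snoc_init_self]
    · rw [← Fin.append_snoc]
      congr 1
      ext i
      refine Fin.lastCases ?_ (fun i => ?_) i <;> simp

end Definable

/-! ### Vaught transforms -/

section Vaught

variable {L : MetricLanguage.{u, v}} {U : Type w} [MetricSpace U]

/-- The metric of a space bounded by `1`, as a function into `[0,1]`. -/
def unitDist [MetricBoundedByOne U] (x y : U) : I :=
  ⟨dist x y, dist_nonneg, MetricBoundedByOne.dist_le_one x y⟩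

/-- The metric Vaught transform of a set `B` of structures: the essential distance, in the sense
of Baire category, from the tuple `a` to the set of tuples `(g q₀, …, g qₖ₋₁)` with `g⁻¹M ∈ B`.
It is `1` if the set of such `g` is meagre. -/
noncomputable def vaughtDist (q : ℕ → U) (B : Set (Mod L U)) (k : ℕ) (M : Mod L U)
    (a : Fin k → U) : I :=
  sInf {r : I | ¬ IsMeagre {g : U ≃ᵢ U | g⁻¹ • M ∈ B ∧ dist (fun i : Fin k => g (q i)) a < r}}

theorem isMeagre_of_lt_vaughtDist {q : ℕ → U} {B : Set (Mod L U)} {k : ℕ} {M : Mod L U}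
    {a : Fin k → U} {r : ℝ} (hr : r < vaughtDist q B k M a) :
    IsMeagre {g : U ≃ᵢ U | g⁻¹ • M ∈ B ∧ dist (fun i : Fin k => g (q i)) a < r} := by
  rcases lt_or_ge r 0 with h0 | h0
  · convert IsMeagre.empty using 1
    refine eq_empty_of_forall_notMem fun g hg => ?_
    exact absurd hg.2 (not_lt.2 (h0.le.trans dist_nonneg))
  · by_contra hcon
    exact absurd (sInf_le (a := (⟨r, h0, hr.le.trans (vaughtDist q B k M a).2.2⟩ : I)) hcon)
      (not_le.2 hr)

theorem vaughtDist_iUnion {ι : Type*} [Countable ι] (q : ℕ → U) (B : ι → Set (Mod L U)) (k : ℕ)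
    (M : Mod L U) (a : Fin k → U) :
    vaughtDist q (⋃ i, B i) k M a = ⨅ i, vaughtDist q (B i) k M a := by
  apply le_antisymm
  · refine le_iInf fun i => sInf_le_sInf fun r hr hcon => hr (hcon.mono fun g hg => ?_)
    exact ⟨mem_iUnion_of_mem i hg.1, hg.2⟩
  · refine le_sInf fun r hr => ?_
    by_contra hcon
    refine hr ((isMeagre_iUnion fun i => isMeagre_of_lt_vaughtDist (r := r)
      ((not_le.1 hcon).trans_le (iInf_le _ i))).mono fun g hg => ?_)
    obtain ⟨i, hi⟩ := mem_iUnion.1 hg.1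
    exact mem_iUnion_of_mem i ⟨hi, hg.2⟩

theorem isOpen_setOf_dist_lt (q : ℕ → U) {k : ℕ} (a : Fin k → U) (r : ℝ) :
    IsOpen {g : U ≃ᵢ U | dist (fun i : Fin k => g (q i)) a < r} :=
  have hc : Continuous fun (g : U ≃ᵢ U) (i : Fin k) => g (q i) :=
    continuous_pi fun i => continuous_isometryEquiv_apply (q i)
  isOpen_lt (hc.dist continuous_const) continuous_const

/-- A set with the property of Baire that is nonmeagre in the open set `V` is comeagre in a
nonempty open subset of `V`. -/
theorem _root_.BaireMeasurableSet.exists_isOpen_isMeagre_diff {X : Type*} [TopologicalSpace X]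
    {s V : Set X} (hs : BaireMeasurableSet s) (hV : IsOpen V) (h : ¬ IsMeagre (s ∩ V)) :
    ∃ W ⊆ V, IsOpen W ∧ W.Nonempty ∧ IsMeagre (W \ s) := by
  obtain ⟨u, hu, hsu⟩ := hs.residualEq_isOpen
  have hd : ∀ᶠ x in residual X, x ∈ s ↔ x ∈ u := eventuallyEq_set.1 hsu
  refine ⟨u ∩ V, inter_subset_right, hu.inter hV, ?_, ?_⟩
  · by_contra hemp
    rw [not_nonempty_iff_eq_empty] at hemp
    refine h (show (s ∩ V)ᶜ ∈ residual X from ?_)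
    filter_upwards [hd] with x hx hxs
    exact (hemp ▸ ⟨hx.1 hxs.1, hxs.2⟩ : x ∈ (∅ : Set X))
  · change ((u ∩ V) \ s)ᶜ ∈ residual X
    filter_upwards [hd] with x hx hxu
    exact hxu.2 (hx.2 hxu.1.1)

theorem dist_unitDist_zero [MetricBoundedByOne U] {k : ℕ} (x y : Fin k → U) :
    dist (fun i => unitDist (x i) (y i)) 0 = dist x y := by
  have h : ∀ i, dist (unitDist (x i) (y i)) 0 = dist (x i) (y i) := fun i => by
    rw [Subtype.dist_eq, Icc.coe_zero, Real.dist_0_eq_abs]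
    exact abs_of_nonneg dist_nonneg
  refine le_antisymm ((dist_pi_le_iff dist_nonneg).2 fun i => ?_)
    ((dist_pi_le_iff dist_nonneg).2 fun i => ?_)
  · exact (h i).trans_le (dist_le_pi_dist x y i)
  · exact (h i).symm.trans_le (dist_le_pi_dist (fun i => unitDist (x i) (y i)) 0 i)

theorem lt_of_projIcc_lt {x : ℝ} {s : I} (h : projIcc 0 1 zero_le_one x < s) : x < s := by
  by_contra hcon
  refine absurd h (not_lt.2 ?_)
  rw [← projIcc_val zero_le_one s]
  exact monotone_projIcc _ (not_lt.1 hcon)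

variable [UrysohnSphere U]

/-- The value attributed to a candidate `b` for the tuple `g q`, when approaching `a`: the distance
from `b` to `a`, plus a penalty `y`, plus `c` times the failure of `b` to be isometric to `q`. -/
noncomputable def candidateValue (q : ℕ → U) {k m : ℕ} (hkm : k ≤ m) (c : ℝ) (y : I)
    (a : Fin k → U) (b : Fin m → U) : I :=
  projIcc 0 1 zero_le_one (dist (fun i => b (Fin.castLE hkm i)) a + y +
    c * dist (fun p : Fin m × Fin m => unitDist (b p.1) (b p.2))
      (fun p => unitDist (q p.1) (q p.2)))

/-- Only the distance from `b` to `a` involves the free variables, and it is `1`-Lipschitz in them;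
so the modulus of the formula does not depend on `c` or on the penalty. -/
theorem definable_iInf_candidateValue (q : ℕ → U) {k m n : ℕ} (hkm : k ≤ m) (c : ℝ)
    (e : Fin k → Fin n) {Ψ : Mod L U → (Fin m → U) → I}
    (hΨ : ∃ w, Definable (fun M (a : Fin (n + m) → U) => Ψ M fun j => a (Fin.natAdd n j)) w ∧
      ∀ δ, (∀ j, δ (Fin.natAdd n j) = 0) → w δ = 0) :
    Definable (fun M (a : Fin n → U) =>
        ⨅ b : Fin m → U, candidateValue q hkm c (Ψ M b) (fun i => a (e i)) b)
      fun δ => ⨆ i, δ (e i) := by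
  obtain ⟨w, hΨ, hw⟩ := hΨ
  let F : Fin k ⊕ Unit ⊕ Fin m × Fin m → Mod L U → (Fin (n + m) → U) → I
    | .inl i, _, a => unitDist (a (Fin.natAdd n (Fin.castLE hkm i))) (a (Fin.castAdd m (e i)))
    | .inr (.inl _), M, a => Ψ M fun j => a (Fin.natAdd n j)
    | .inr (.inr p), _, a => unitDist (a (Fin.natAdd n p.1)) (a (Fin.natAdd n p.2))
  let W : Fin k ⊕ Unit ⊕ Fin m × Fin m → (Fin (n + m) → ℝ≥0∞) → ℝ≥0∞
    | .inl i, δ => δ (Fin.natAdd n (Fin.castLE hkm i)) + δ (Fin.castAdd m (e i))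
    | .inr (.inl _), δ => w δ
    | .inr (.inr p), δ => δ (Fin.natAdd n p.1) + δ (Fin.natAdd n p.2)
  have hF : ∀ i, Definable (F i) (W i)
    | .inl i => Definable.dist (.var _) (.var _)
    | .inr (.inl _) => hΨ
    | .inr (.inr p) => Definable.dist (.var _) (.var _)
  let z : Fin m × Fin m → I := fun p => unitDist (q p.1) (q p.2)
  let h : (Fin k ⊕ Unit ⊕ Fin m × Fin m → I) → I := fun x =>
    projIcc 0 1 zero_le_one (dist (fun i => x (.inl i)) 0 + x (.inr (.inl ())) +
      c * dist (fun p => x (.inr (.inr p))) z)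
  have hh : Continuous h := continuous_projIcc.comp (by fun_prop)
  have key := (Definable.conn hF hh).iInf_append
  have hval : ∀ M (a : Fin n → U) (b : Fin m → U), h (fun i => F i M (Fin.append a b)) =
      candidateValue q hkm c (Ψ M b) (fun i => a (e i)) b := fun M a b => by
    simp only [h, F, z, candidateValue, Fin.append_left, Fin.append_right,
      dist_unitDist_zero]
  simp only [hval] at key
  refine key.mono fun δ => iSup_le fun x => iSup_le fun x' => iSup_le fun hx => ?_
  have h1 : ∀ i, edist (x (.inl i)) (x' (.inl i)) ≤ δ (e i) := fun i => by
    simpa [W] using hx (.inl i)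
  have h2 : x (.inr (.inl ())) = x' (.inr (.inl ())) := by
    simpa [W, hw] using hx (.inr (.inl ()))
  have h3 : ∀ p, x (.inr (.inr p)) = x' (.inr (.inr p)) := fun p => by
    simpa [W] using hx (.inr (.inr p))
  refine ((LipschitzWith.projIcc zero_le_one).edist_le_mul _ _).trans ?_
  simp only [h2, h3, edist_add_right, ENNReal.coe_one, one_mul]
  refine ((LipschitzWith.dist_left _).edist_le_mul _ _).trans ?_
  rw [ENNReal.coe_one, one_mul, edist_pi_le_iff]
  exact fun i => (h1 i).trans (le_iSup (fun i => δ (e i)) i)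

/-- Approximate homogeneity turns the essential distance into a formula. Here `Ψ i M b` is a
penalty that is small only if, near every `g` that moves `q` close to `b`, there are nonmeagrely
many `h` with `h⁻¹M ∈ C`; conversely, an open set with nonmeagrely many such `h` has an element `g`
for which some `Ψ i` vanishes at `g q`. The condition on `Ψ` in `hΨ` says that its syntactic modulus
depends on the quantified variables only. -/
theorem definable_vaughtDist {q : ℕ → U} {C : Set (Mod L U)} {k n : ℕ}
    (e : Fin k → Fin n) {ι : Type*} [Countable ι] {m : ι → ℕ} (hm : ∀ i, k ≤ m i)
    {c : ι → ℝ} (hc : ∀ i, 1 ≤ c i) {Ψ : ∀ i, Mod L U → (Fin (m i) → U) → I}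
    (hΨ : ∀ i, ∃ w, Definable
      (fun M (a : Fin (n + m i) → U) => Ψ i M fun j => a (Fin.natAdd n j)) w ∧
      ∀ δ, (∀ j, δ (Fin.natAdd n j) = 0) → w δ = 0)
    (hsound : ∀ i M b (g : U ≃ᵢ U), Ψ i M b + c i * dist (fun j : Fin (m i) => g (q j)) b < 1 →
      ∀ V, IsOpen V → g ∈ V → ¬ IsMeagre ({h : U ≃ᵢ U | h⁻¹ • M ∈ C} ∩ V))
    (hcomplete : ∀ M V, IsOpen V → ¬ IsMeagre ({h : U ≃ᵢ U | h⁻¹ • M ∈ C} ∩ V) →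
      ∃ i, ∃ g ∈ V, Ψ i M (fun j : Fin (m i) => g (q j)) = 0) :
    Definable (fun M (a : Fin n → U) => vaughtDist q C k M fun i => a (e i))
      fun δ => ⨆ i, δ (e i) := by
  have hval : ∀ M (a : Fin k → U), vaughtDist q C k M a =
      ⨅ i, ⨅ b, candidateValue q (hm i) (c i) (Ψ i M b) a b := fun M a => by
    apply le_antisymm
    · refine le_iInf fun i => le_iInf fun b => le_of_forall_gt_imp_ge_of_dense fun s hs => ?_
      have hx := lt_of_projIcc_lt hs
      set D := dist (fun p : Fin (m i) × Fin (m i) => unitDist (b p.1) (b p.2))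
        (fun p => unitDist (q p.1) (q p.2)) with hD
      have hci := hc i
      -- Amalgamation needs a positive `ε`, whereas the discrepancy `D` may vanish.
      obtain ⟨ε, hDε, hε⟩ : ∃ ε > D, dist (fun j => b (Fin.castLE (hm i) j)) a + Ψ i M b +
          c i * ε < s := by
        have hcont : Continuous fun ε => dist (fun j => b (Fin.castLE (hm i) j)) a + Ψ i M b +
          c i * ε := by fun_prop
        have h1 := (hcont.tendsto D).eventually (gt_mem_nhds hx)
        obtain ⟨ε, hε⟩ := ((h1.filter_mono nhdsWithin_le_nhds).and
          (self_mem_nhdsWithin (s := Ioi D))).exists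
        exact ⟨ε, hε.2, hε.1⟩
      have hε0 : 0 < ε := dist_nonneg.trans_lt hDε
      obtain ⟨g, hg⟩ := UrysohnSphere.exists_dist_apply_le (U := U)
        (x := fun j : Fin (m i) => q j) (y := b) hε0 fun j l => by
          refine le_trans ?_ hDε.le
          rw [abs_sub_comm]
          exact dist_le_pi_dist (fun p : Fin (m i) × Fin (m i) => unitDist (b p.1) (b p.2))
            (fun p => unitDist (q p.1) (q p.2)) (j, l)
      have hgb : dist (fun j : Fin (m i) => g (q j)) b ≤ ε := (dist_pi_le_iff hε0.le).2 hg
      have hs1 : (s : ℝ) ≤ 1 := s.2.2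
      have hba := dist_nonneg (x := fun j => b (Fin.castLE (hm i) j)) (y := a)
      have hΨ0 : 0 ≤ (Ψ i M b : ℝ) := (Ψ i M b).2.1
      refine sInf_le (hsound i M b g ?_ _ (isOpen_setOf_dist_lt q a s) ?_)
      · have := mul_le_mul_of_nonneg_left hgb (zero_le_one.trans hci)
        linarith
      · have h1 : dist (fun j : Fin k => g (q j)) (fun j => b (Fin.castLE (hm i) j)) ≤ ε :=
          (dist_pi_le_iff hε0.le).2 fun j => hg (Fin.castLE (hm i) j)
        have h2 := dist_triangle (fun j : Fin k => g (q j)) (fun j => b (Fin.castLE (hm i) j)) a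
        have h3 := mul_le_mul_of_nonneg_right hci hε0.le
        change dist _ _ < _
        linarith
    · refine le_sInf fun r hr => ?_
      obtain ⟨i, g, hg, hgi⟩ := hcomplete M _ (isOpen_setOf_dist_lt q a r) hr
      refine (iInf_le _ i).trans ((iInf_le _ fun j : Fin (m i) => g (q j)).trans ?_)
      have h1 : (fun p : Fin (m i) × Fin (m i) => unitDist (g (q p.1)) (g (q p.2))) =
          fun p => unitDist (q p.1) (q p.2) := funext fun p => Subtype.ext (g.dist_eq _ _)
      rw [candidateValue, hgi, h1, dist_self, mul_zero, add_zero, Icc.coe_zero, add_zero,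
        ← projIcc_val zero_le_one r]
      exact monotone_projIcc _ (le_of_lt hg)
  simp only [hval]
  refine Definable.iInf (fun i => definable_iInf_candidateValue q (hm i) (c i) e (hΨ i)) ?_
  exact fun t => iSup_le fun _ => le_rfl

end Vaught

/-! ### Borel sets have definable Vaught transforms -/

section Borel

variable {L : MetricLanguage.{u, v}} {U : Type w} [MetricSpace U] [UrysohnSphere U]

/-- All Vaught transforms of the set `B` of structures are definable, and `B` pulls back along
orbit maps to sets with the property of Baire. -/
structure IsVaughtDefinable (q : ℕ → U) (B : Set (Mod L U)) : Prop where
  baireMeasurableSet : ∀ M, BaireMeasurableSet {g : U ≃ᵢ U | g⁻¹ • M ∈ B}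
  definable : ∀ {k n : ℕ} (e : Fin k → Fin n),
    Definable (fun M (a : Fin n → U) => vaughtDist q B k M fun i => a (e i)) fun δ => ⨆ i, δ (e i)

theorem IsVaughtDefinable.empty (q : ℕ → U) : IsVaughtDefinable q (∅ : Set (Mod L U)) where
  baireMeasurableSet M := by simpa using (isOpen_empty (X := U ≃ᵢ U)).baireMeasurableSet
  definable {k n} e := by
    have : ∀ M (a : Fin k → U), vaughtDist q (∅ : Set (Mod L U)) k M a = ⊤ := fun M a => by
      simp [vaughtDist, IsMeagre.empty]
    simpa only [this] using Definable.const ⊤ _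

theorem IsVaughtDefinable.iUnion {q : ℕ → U} {B : ℕ → Set (Mod L U)}
    (h : ∀ i, IsVaughtDefinable q (B i)) : IsVaughtDefinable q (⋃ i, B i) where
  baireMeasurableSet M := by
    have : {g : U ≃ᵢ U | g⁻¹ • M ∈ ⋃ i, B i} = ⋃ i, {g : U ≃ᵢ U | g⁻¹ • M ∈ B i} := by
      ext; simp
    rw [this]
    exact .iUnion fun i => (h i).baireMeasurableSet M
  definable {k n} e := by
    simpa only [vaughtDist_iUnion] using
      Definable.iInf (fun i => (h i).definable e) fun t => iSup_le fun _ => le_rfl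

variable [BaireSpace (U ≃ᵢ U)]

/-- The complement `Bᶜ` is nonmeagre in an open set exactly if `B` is meagre in some smaller open
set, that is, if the essential distance to `B` is positive at some `g q`. -/
theorem IsVaughtDefinable.compl {q : ℕ → U} (hq : DenseRange q) {B : Set (Mod L U)}
    (h : IsVaughtDefinable q B) : IsVaughtDefinable q Bᶜ where
  baireMeasurableSet M := (h.baireMeasurableSet M).compl
  definable {k n} e := by
    refine definable_vaughtDist e (ι := ℕ × ℕ) (m := fun i => k + i.1)
      (fun i => Nat.le_add_right k i.1) (c := fun i => i.2 + 1) (fun i => by simp)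
      (Ψ := fun i M b => projIcc 0 1 zero_le_one
        (1 - (i.2 + 1) * (vaughtDist q B (k + i.1) M b : ℝ))) (fun i => ?_) ?_ ?_
    · obtain ⟨w, hw, hw0⟩ := (h.definable (fun j : Fin (k + i.1) => Fin.natAdd n j)).comp
        (h := fun x : I => projIcc 0 1 zero_le_one (1 - ((i.2 : ℝ) + 1) * (x : ℝ)))
        (continuous_projIcc.comp (by fun_prop))
      exact ⟨w, hw, fun δ hδ => hw0 δ (by simp [hδ])⟩
    · intro i M b g hg V hV hgV hcon
      set D := vaughtDist q B (k + i.1) M b with hD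
      have hgD : dist (fun j : Fin (k + i.1) => g (q j)) b < D := by
        have h1 : 1 - ((i.2 : ℝ) + 1) * (D : ℝ) ≤
            (projIcc 0 1 zero_le_one (1 - ((i.2 : ℝ) + 1) * (D : ℝ)) : I) := by
          rw [coe_projIcc]
          refine (le_min ?_ le_rfl).trans (le_max_right _ _)
          have := D.2.1
          nlinarith
        have h2 : (0 : ℝ) < (i.2 : ℝ) + 1 := by positivity
        refine lt_of_mul_lt_mul_left ?_ h2.le
        linarith
      obtain ⟨r, hr, hrD⟩ := exists_between hgD
      refine not_isMeagre_of_isOpen (hV.inter (isOpen_setOf_dist_lt q b r)) ⟨g, hgV, hr⟩ ?_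
      refine (hcon.union (isMeagre_of_lt_vaughtDist hrD)).mono fun x hx => ?_
      by_cases hxB : x⁻¹ • M ∈ B
      · exact .inr ⟨hxB, hx.2⟩
      · exact .inl ⟨hxB, hx.1⟩
    · intro M V hV hcon
      obtain ⟨W, hWV, hW, ⟨g, hg⟩, hWm⟩ :=
        (h.baireMeasurableSet M).compl.exists_isOpen_isMeagre_diff hV hcon
      obtain ⟨m, hkm, δ, hδ, hm⟩ := exists_dist_lt_imp_mem_of_mem_nhds hq (hW.mem_nhds hg) k
      obtain ⟨l, rfl⟩ := Nat.exists_eq_add_of_le hkm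
      obtain ⟨j, hj⟩ := exists_nat_one_div_lt hδ
      refine ⟨(l, j), g, hWV hg, ?_⟩
      have hj1 : 1 / ((j : ℝ) + 1) ≤ 1 := (div_le_one (by positivity)).2 (by simp)
      have hD : (⟨1 / ((j : ℝ) + 1), by positivity, hj1⟩ : I) ≤
          vaughtDist q B (k + l) M fun i => g (q i) := by
        refine le_sInf fun r hr => ?_
        by_contra hlt
        have hrδ : (r : ℝ) < δ := lt_trans (not_le.1 hlt) hj
        refine hr (hWm.mono ?_)
        rintro x ⟨hxB, hx⟩
        exact ⟨hm x (hx.trans hrδ), fun hx' => hx' hxB⟩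
      refine projIcc_of_le_left zero_le_one ?_
      have hD' : 1 / ((j : ℝ) + 1) ≤ vaughtDist q B (k + l) M fun i => g (q i) := hD
      rw [div_le_iff₀ (by positivity)] at hD'
      dsimp only
      linarith

/-- A predicate that defines an open condition on structures: it is equivariant, uniformly
continuous (uniformly over all structures), and definable in any larger context. -/
structure IsAtomic {m : ℕ} (Θ : Mod L U → (Fin m → U) → I) : Prop where
  smul : ∀ (g : U ≃ᵢ U) M a, Θ (g⁻¹ • M) a = Θ M fun i => g (a i)
  uniform : ∀ ε > 0, ∃ δ > 0, ∀ M a b, dist a b < δ → dist (Θ M a) (Θ M b) < ε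
  definable : ∀ {n : ℕ} (f : Fin m → Fin n), ∃ w,
    Definable (fun M (a : Fin n → U) => Θ M fun j => a (f j)) w ∧
      ∀ δ, (∀ j, δ (f j) = 0) → w δ = 0

omit [BaireSpace (U ≃ᵢ U)] in
theorem IsAtomic.continuous {m : ℕ} {Θ : Mod L U → (Fin m → U) → I} (h : IsAtomic Θ)
    (M : Mod L U) : Continuous (Θ M) := by
  refine Metric.continuous_iff.2 fun b ε hε => ?_
  obtain ⟨δ, hδ, hd⟩ := h.uniform ε hε
  exact ⟨δ, hδ, fun a hab => hd M a b hab⟩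

theorem IsAtomic.isVaughtDefinable {q : ℕ → U} {m : ℕ} {Θ : Mod L U → (Fin m → U) → I}
    (h : IsAtomic Θ) (r : I) : IsVaughtDefinable q {M | Θ M (fun i => q i) < r} := by
  have hS : ∀ M, {g : U ≃ᵢ U | g⁻¹ • M ∈ {M | Θ M (fun i => q i) < r}} =
      {g : U ≃ᵢ U | Θ M (fun i => g (q i)) < r} := fun M => by
    ext g
    simp only [mem_ofPred_eq, h.smul]
  have hopen : ∀ M, IsOpen {g : U ≃ᵢ U | Θ M (fun i => g (q i)) < r} := fun M =>
    isOpen_lt ((h.continuous M).comp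
      (continuous_pi fun i => continuous_isometryEquiv_apply (q i))) continuous_const
  refine ⟨fun M => by rw [hS]; exact (hopen M).baireMeasurableSet, fun {k n} e => ?_⟩
  choose δ hδ hδΘ using fun j : ℕ => h.uniform (1 / ((j : ℝ) + 1)) (by positivity)
  -- The penalty vanishes if `r - Θ` is at least `2 / (j + 1)`, and is at least `1` if it is
  -- at most `1 / (j + 1)`; moving the tuple by less than `δ j` keeps `Θ` within `1 / (j + 1)`.
  refine definable_vaughtDist e (ι := ℕ) (m := fun _ => max k m) (fun _ => le_max_left k m)
    (c := fun j => max 1 (1 / δ j)) (fun j => le_max_left _ _)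
    (Ψ := fun j M b => projIcc 0 1 zero_le_one
      (2 - (j + 1) * (r - Θ M fun i => b (Fin.castLE (le_max_right k m) i) : ℝ)))
    (fun j => ?_) ?_ ?_
  · obtain ⟨w, hw, hw0⟩ := h.definable
      fun i : Fin m => Fin.natAdd n (Fin.castLE (le_max_right k m) i)
    obtain ⟨w', hw', hw0'⟩ := hw.comp
      (h := fun x : I => projIcc 0 1 zero_le_one (2 - ((j : ℝ) + 1) * ((r : ℝ) - (x : ℝ))))
      (continuous_projIcc.comp (by fun_prop))
    exact ⟨w', hw', fun δ hδ => hw0' δ (hw0 δ fun i => hδ _)⟩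
  · intro j M b g hg V hV hgV
    rw [hS]
    refine not_isMeagre_of_isOpen ((hopen M).inter hV) ⟨g, ?_, hgV⟩
    set x := Θ M fun i => b (Fin.castLE (le_max_right k m) i) with hx
    set d := dist (fun i : Fin (max k m) => g (q i)) b with hd
    set p : I := projIcc 0 1 zero_le_one (2 - ((j : ℝ) + 1) * ((r : ℝ) - x)) with hp
    have hp0 : (0 : ℝ) ≤ p := p.2.1
    have hd0 : 0 ≤ d := dist_nonneg
    have hdδ : d < δ j := by
      have h1 : 1 / δ j * d < 1 :=
        (mul_le_mul_of_nonneg_right (le_max_right 1 (1 / δ j)) hd0).trans_lt (by linarith)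
      rwa [one_div_mul_eq_div, div_lt_one (hδ j)] at h1
    have hp1 : p < 1 := by
      have := mul_nonneg (zero_le_one.trans (le_max_left 1 (1 / δ j))) hd0
      exact Subtype.coe_lt_coe.1 (by rw [Icc.coe_one]; linarith)
    have h2 : 2 - ((j : ℝ) + 1) * ((r : ℝ) - x) < 1 := lt_of_projIcc_lt hp1
    have h3 : dist (Θ M fun i => g (q i)) x < 1 / ((j : ℝ) + 1) := by
      refine hδΘ j M _ _ (lt_of_le_of_lt ?_ hdδ)
      exact (dist_pi_le_iff hd0).2 fun i =>
        dist_le_pi_dist (fun i : Fin (max k m) => g (q i)) b (Fin.castLE (le_max_right k m) i)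
    rw [Subtype.dist_eq, Real.dist_eq] at h3
    have h4 := (abs_lt.1 h3).2
    have h5 : 1 / ((j : ℝ) + 1) < r - x := by
      rw [div_lt_iff₀ (by positivity)]
      linarith
    have h6 : ((Θ M fun i => g (q i) : I) : ℝ) < r := by linarith
    exact h6
  · intro M V hV hcon
    rw [hS] at hcon
    obtain ⟨g, hgr, hgV⟩ := nonempty_of_not_isMeagre hcon
    have hpos : (0 : ℝ) < (r - Θ M fun i => g (q i)) / 2 :=
      half_pos (sub_pos.2 (Subtype.coe_lt_coe.2 hgr))
    obtain ⟨j, hj⟩ := exists_nat_one_div_lt hpos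
    refine ⟨j, g, hgV, projIcc_of_le_left zero_le_one ?_⟩
    rw [div_lt_iff₀ (by positivity)] at hj
    simp only [Fin.val_castLE]
    linarith

theorem Modulus.exists_pos_of_pos (ϖ : Modulus) {ε : ℝ} (hε : 0 < ε) :
    ∃ δ > 0, ∀ s : ℝ≥0, (s : ℝ) < δ → (ϖ.toFun s : ℝ) < ε := by
  obtain ⟨δ, hδ, h⟩ := Metric.continuous_iff.1 ϖ.continuous_toFun 0 ε hε
  refine ⟨δ, hδ, fun s hs => ?_⟩
  simpa [ϖ.map_zero, NNReal.dist_eq] using h s (by simpa [NNReal.dist_eq] using hs)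

theorem Modulus.bound_zero (ϖ : Modulus) : ϖ.bound 0 = 0 := by
  simp [Modulus.bound, ϖ.map_zero]

omit [BaireSpace (U ≃ᵢ U)] in
theorem isAtomic_fun {m l : ℕ} (f : L.Functions l) (c : Fin l → Fin m) (j : Fin m) :
    IsAtomic fun (M : Mod L U) (a : Fin m → U) =>
      unitDist (M.funMap f fun i => a (c i)) (a j) where
  smul g M a := by
    refine Subtype.ext ?_
    change dist (g⁻¹ (M.funMap f fun i => g⁻¹⁻¹ (a (c i)))) (a j) = dist (M.funMap f _) (g (a j))
    rw [← g.dist_eq, inv_inv, IsometryEquiv.apply_inv_self]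
  uniform ε hε := by
    obtain ⟨δ, hδ, h⟩ := (L.funModulus f).exists_pos_of_pos (half_pos hε)
    refine ⟨min δ (ε / 2), by positivity, fun M a b hab => ?_⟩
    have h1 : dist (fun i => a (c i)) (fun i => b (c i)) ≤ dist a b :=
      (dist_pi_le_iff dist_nonneg).2 fun i => dist_le_pi_dist a b (c i)
    have h2 : dist (M.funMap f fun i => a (c i)) (M.funMap f fun i => b (c i)) < ε / 2 :=
      lt_of_le_of_lt ((M.1 ⟨l, f⟩).2 _ _)
        (h _ ((h1.trans_lt hab).trans_le (min_le_left _ _)))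
    have h3 := (dist_le_pi_dist a b j).trans_lt (hab.trans_le (min_le_right _ _))
    exact (dist_dist_dist_le _ _ _ _).trans_lt (by linarith)
  definable {n} e := by
    refine ⟨_, Definable.dist (.func f fun i => .var (e (c i))) (.var (e j)), fun δ hδ => ?_⟩
    simp [termModulus, hδ, Modulus.bound_zero]

omit [BaireSpace (U ≃ᵢ U)] in
theorem isAtomic_rel {m l : ℕ} (R : L.Relations l) (c : Fin l → Fin m) :
    IsAtomic fun (M : Mod L U) (a : Fin m → U) => M.relMap R fun i => a (c i) where
  smul g M a := by
    change M.relMap R (fun i => g⁻¹⁻¹ (a (c i))) = _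
    rw [inv_inv]
  uniform ε hε := by
    obtain ⟨δ, hδ, h⟩ := (L.relModulus R).exists_pos_of_pos hε
    refine ⟨δ, hδ, fun M a b hab => ?_⟩
    have h1 : dist (fun i => a (c i)) (fun i => b (c i)) ≤ dist a b :=
      (dist_pi_le_iff dist_nonneg).2 fun i => dist_le_pi_dist a b (c i)
    exact lt_of_le_of_lt ((M.2 ⟨l, R⟩).2 _ _) (h _ (h1.trans_lt hab))
  definable {n} e := by
    refine ⟨_, Definable.rel R fun i => .var (e (c i)), fun δ hδ => ?_⟩
    simp [termModulus, hδ, Modulus.bound_zero]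

end Borel

/-! ### Generators of the Borel structure -/

section Generators

variable {L : MetricLanguage.{u, v}} {U : Type w} [MetricSpace U]

theorem Mod.continuous_of_forall {X : Type*} [TopologicalSpace X] {F : X → Mod L U}
    (hf : ∀ {n : ℕ} (f : L.Functions n) (a : Fin n → U), Continuous fun x => (F x).funMap f a)
    (hR : ∀ {n : ℕ} (R : L.Relations n) (a : Fin n → U), Continuous fun x => (F x).relMap R a) :
    Continuous F := by
  have h1 : Continuous fun x => (F x).1 := continuous_pi fun s =>
    Continuous.subtype_mk (continuous_pi fun a => hf s.2 a) _
  have h2 : Continuous fun x => (F x).2 := continuous_pi fun s =>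
    Continuous.subtype_mk (continuous_pi fun a => hR s.2 a) _
  exact h1.prodMk h2

theorem exists_tuple_dist_lt {q : ℕ → U} (hq : DenseRange q) {l : ℕ} (a : Fin l → U) {ε : ℝ}
    (hε : 0 < ε) : ∃ c : Fin l → ℕ, dist a (fun i => q (c i)) < ε := by
  choose c hc using fun i => hq.exists_dist_lt (a i) hε
  exact ⟨c, (dist_pi_lt_iff hε).2 hc⟩

/-- As the interpretations of a symbol are equicontinuous, the topology of `Mod(L, U)`, and hence
its Borel structure, is determined by the values on tuples from a dense sequence; there are only
countably many of these. -/
theorem Mod.borel_le [Countable L.toLanguage.Symbols] [MetricBoundedByOne U] {q : ℕ → U}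
    (hq : DenseRange q) {m : MeasurableSpace (Mod L U)}
    (hf : ∀ {l : ℕ} (f : L.Functions l) (c : Fin l → ℕ) (j : ℕ),
      Measurable[m] fun M : Mod L U => unitDist (M.funMap f fun i => q (c i)) (q j))
    (hR : ∀ {l : ℕ} (R : L.Relations l) (c : Fin l → ℕ),
      Measurable[m] fun M : Mod L U => M.relMap R fun i => q (c i)) :
    borel (Mod L U) ≤ m := by
  have : Countable (Σ l, L.Functions l) :=
    Function.Injective.countable (β := L.toLanguage.Symbols) Sum.inl_injective
  have : Countable (Σ l, L.Relations l) :=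
    Function.Injective.countable (β := L.toLanguage.Symbols) Sum.inr_injective
  let E : Mod L U → ((Σ s : (Σ l, L.Functions l), (Fin s.1 → ℕ) × ℕ) ⊕
      (Σ s : (Σ l, L.Relations l), (Fin s.1 → ℕ)) → I) := fun M => Sum.elim
    (fun s => unitDist (M.funMap s.1.2 fun i => q (s.2.1 i)) (q s.2.2))
    (fun s => M.relMap s.1.2 fun i => q (s.2 i))
  let τ : TopologicalSpace (Mod L U) := .induced E inferInstance
  have hE : ∀ s, Continuous[τ, _] fun M => E M s := fun s =>
    (continuous_apply s).comp continuous_induced_dom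
  have hτ : τ ≤ Mod.instTopologicalSpace := by
    rw [← continuous_id_iff_le]
    refine @Mod.continuous_of_forall L U _ (Mod L U) τ id (fun {l} f a => ?_) (fun {l} R a => ?_)
    · rw [continuous_iff_continuousAt]
      intro M
      refine Metric.tendsto_nhds.2 fun ε hε => ?_
      obtain ⟨δ, hδ, h⟩ := (L.funModulus f).exists_pos_of_pos (by positivity : 0 < ε / 4)
      obtain ⟨c, hc⟩ := exists_tuple_dist_lt hq a hδ
      obtain ⟨j, hj⟩ := hq.exists_dist_lt (M.funMap f fun i => q (c i))
        (by positivity : 0 < ε / 4)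
      have hcont : Continuous[τ, _] fun N : Mod L U => dist (N.funMap f fun i => q (c i)) (q j) :=
        continuous_subtype_val.comp (hE (.inl ⟨⟨l, f⟩, c, j⟩))
      filter_upwards [(hcont.tendsto M).eventually (gt_mem_nhds hj)] with N hN
      have h1 : ∀ N : Mod L U, dist (N.funMap f a) (N.funMap f fun i => q (c i)) < ε / 4 :=
        fun N => lt_of_le_of_lt ((N.1 ⟨l, f⟩).2 _ _) (h _ hc)
      have h2 := dist_triangle4 (N.funMap f a) (N.funMap f fun i => q (c i)) (q j) (M.funMap f a)
      have h3 := dist_triangle_left (q j) (M.funMap f a) (M.funMap f fun i => q (c i))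
      have h4 := dist_comm (M.funMap f a) (M.funMap f fun i => q (c i))
      have := h1 N
      have := h1 M
      simp only [id]
      linarith
    · rw [continuous_iff_continuousAt]
      intro M
      refine Metric.tendsto_nhds.2 fun ε hε => ?_
      obtain ⟨δ, hδ, h⟩ := (L.relModulus R).exists_pos_of_pos (by positivity : 0 < ε / 3)
      obtain ⟨c, hc⟩ := exists_tuple_dist_lt hq a hδ
      have hcont : Continuous[τ, _] fun N : Mod L U => N.relMap R fun i => q (c i) :=
        hE (.inr ⟨⟨l, R⟩, c⟩)
      filter_upwards [Metric.tendsto_nhds.1 (hcont.tendsto M) (ε / 3) (by positivity)] with N hN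
      have h1 : ∀ N : Mod L U, dist (N.relMap R a) (N.relMap R fun i => q (c i)) < ε / 3 :=
        fun N => lt_of_le_of_lt ((N.2 ⟨l, R⟩).2 _ _) (h _ hc)
      have h2 := dist_triangle4 (N.relMap R a) (N.relMap R fun i => q (c i))
        (M.relMap R fun i => q (c i)) (M.relMap R a)
      have h4 := dist_comm (M.relMap R a) (M.relMap R fun i => q (c i))
      have := h1 N
      have := h1 M
      simp only [id]
      linarith
  refine (borel_anti hτ).trans ?_
  rw [borel_comap, ← (inferInstance : BorelSpace (_ → I)).measurable_eq]
  refine Measurable.comap_le (measurable_pi_iff.2 fun s => ?_)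
  rcases s with s | s
  · exact hf s.1.2 s.2.1 s.2.2
  · exact hR s.1.2 s.2

end Generators

/-! ### Invariant Borel functions -/

section Sentences

variable {L : MetricLanguage.{u, v}} {U : Type w} [MetricSpace U]

/-- On the empty tuple, the Vaught transform of an invariant set only decides membership. -/
theorem vaughtDist_zero_of_invariant [BaireSpace (U ≃ᵢ U)] (q : ℕ → U) {B : Set (Mod L U)}
    (hB : ∀ (g : U ≃ᵢ U) M, g • M ∈ B ↔ M ∈ B) (M : Mod L U) (a : Fin 0 → U) [Decidable (M ∈ B)] :
    vaughtDist q B 0 M a = if M ∈ B then 0 else 1 := by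
  split_ifs with hM
  · refine le_antisymm (le_of_forall_gt_imp_ge_of_dense fun s hs => ?_) bot_le
    refine sInf_le ?_
    have : {g : U ≃ᵢ U | g⁻¹ • M ∈ B ∧ dist (fun i : Fin 0 => g (q i)) a < s} = univ := by
      refine eq_univ_of_forall fun g => ⟨(hB _ _).2 hM, ?_⟩
      rw [Subsingleton.elim (fun i : Fin 0 => g (q i)) a, dist_self]
      exact hs
    rw [mem_ofPred_eq, this]
    exact not_isMeagre_of_isOpen isOpen_univ univ_nonempty
  · have : ∀ g : U ≃ᵢ U, ¬ g⁻¹ • M ∈ B := fun g => mt (hB _ _).1 hM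
    simp only [vaughtDist, this, false_and]
    simp [IsMeagre.empty]
    rfl

variable [UrysohnSphere U]

theorem isVaughtDefinable_of_borel [Countable L.toLanguage.Symbols] [BaireSpace (U ≃ᵢ U)]
    {q : ℕ → U} (hq : DenseRange q) {B : Set (Mod L U)} (hB : MeasurableSet[borel _] B) :
    IsVaughtDefinable q B := by
  let m : MeasurableSpace (Mod L U) :=
    { MeasurableSet' := IsVaughtDefinable q
      measurableSet_empty := .empty q
      measurableSet_compl := fun _ h => h.compl hq
      measurableSet_iUnion := fun _ h => .iUnion h }
  -- Finitely many indices lie in a common initial segment of the dense sequence.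
  refine Mod.borel_le (m := m) hq (fun {l} f c j => ?_) (fun {l} R c => ?_) B hB
  · refine measurable_of_Iio fun r => ?_
    have hc : ∀ i, c i < j + ∑ i, c i + 1 := fun i =>
      Nat.lt_succ_of_le ((Finset.single_le_sum (fun _ _ => Nat.zero_le _)
        (Finset.mem_univ i)).trans (Nat.le_add_left _ _))
    exact (isAtomic_fun (U := U) f (fun i => ⟨c i, hc i⟩)
      ⟨j, Nat.lt_succ_of_le (Nat.le_add_right _ _)⟩).isVaughtDefinable (q := q) r
  · refine measurable_of_Iio fun r => ?_
    have hc : ∀ i, c i < ∑ i, c i + 1 := fun i =>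
      Nat.lt_succ_of_le (Finset.single_le_sum (fun _ _ => Nat.zero_le _) (Finset.mem_univ i))
    exact (isAtomic_rel (U := U) R fun i => (⟨c i, hc i⟩ : Fin _)).isVaughtDefinable (q := q) r

end Sentences

end MetricLogic

open MetricLogic in
/-- A metric López-Escobar theorem. -/
theorem theorem1 (L : MetricLogic.MetricLanguage.{u, v}) [Countable L.toLanguage.Symbols]
    (U : Type w) [MetricSpace U] [MetricLogic.UrysohnSphere U]
    (A : MetricLogic.GreySubset (MetricLogic.Mod L U))
    (hA : A.IsBorel) (hinv : A.IsInvariant (U ≃ᵢ U)) :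
    ∃ φ : MetricLogic.Sentence L, ∀ M : MetricLogic.Mod L U, A M = φ.eval M := by
  classical
  have := UrysohnSphere.complete (U := U)
  have := UrysohnSphere.separable (U := U)
  have : Nonempty U := by
    have : MetricBoundedByOne Unit := ⟨fun _ _ => by simp⟩
    obtain ⟨f, -⟩ := UrysohnSphere.universal (U := U) Unit
    exact ⟨f ()⟩
  have hq := TopologicalSpace.denseRange_denseSeq U
  set q := TopologicalSpace.denseSeq U
  have := baireSpace_isometryEquiv hq
  let r := TopologicalSpace.denseSeq I
  have hr : DenseRange r := TopologicalSpace.denseRange_denseSeq I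
  let B : ℕ → Set (Mod L U) := fun j => {M | r j < A M}
  have hB : ∀ j, IsVaughtDefinable q (B j) := fun j => by
    have h : @MeasurableSet I (borel I) (Set.Ioi (r j)) :=
      MeasurableSpace.measurableSet_generateFrom
        (by rw [Set.mem_ofPred_eq]; exact isOpen_Ioi)
    exact isVaughtDefinable_of_borel hq (hA h)
  have hBinv : ∀ j (g : U ≃ᵢ U) M, g • M ∈ B j ↔ M ∈ B j := fun j g M => by
    simp only [B, Set.mem_ofPred_eq, hinv g M]
  have hdef : ∀ j, Definable (fun M (a : Fin 0 → U) =>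
      min (r j) (unitInterval.symm (vaughtDist q (B j) 0 M a))) fun _ => 0 := fun j => by
    obtain ⟨w, hw, hw0⟩ := ((hB j).definable (id : Fin 0 → Fin 0)).comp
      (h := fun x => min (r j) (unitInterval.symm x)) (by fun_prop)
    exact hw.mono fun δ => (hw0 δ (by simp)).le
  obtain ⟨φ, hφ, hφA, -⟩ := Definable.iSup_nat hdef fun t => zero_le
  refine ⟨⟨φ, hφ⟩, fun M => ?_⟩
  change A M = φ.eval M _
  rw [hφA]
  simp only [vaughtDist_zero_of_invariant q (hBinv _)]
  -- `A M` is the supremum of those terms of the dense sequence `r` that lie below it.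
  apply le_antisymm
  · refine le_of_forall_lt_imp_le_of_dense fun s hs => ?_
    obtain ⟨j, hj⟩ := hr.exists_mem_open isOpen_Ioo (Set.nonempty_Ioo.2 hs)
    refine hj.1.le.trans (le_trans ?_ (le_iSup _ j))
    rw [if_pos (show M ∈ B j from hj.2), unitInterval.symm_zero]
    exact le_min le_rfl le_top
  · refine iSup_le fun j => ?_
    split_ifs with h
    · exact (min_le_left _ _).trans (le_of_lt h)
    · rw [unitInterval.symm_one]
      exact (min_le_right _ _).trans bot_le
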